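/- Setting. A database is $X=(x_1,\dots,x_N)\in\mathcal X^N$; two databases are neighbouring if they differ in exactly one row. A randomized mechanism $\mathcal M$ on $\mathcal X^N$ is $(\epsilon,\delta)$-differentially private if $\Pr[\mathcal M(X)\in S]\le e^{\epsilon}\Pr[\mathcal M(X')\in S]+\delta$ for all neighbouring $X,X'$ and all measurable sets $S$ of outputs. A ticket of a network with parameters in $\mathbb R^d$ and loss $\mathcal L(\theta,x)$ is a pair $(m,\theta^{0})$ of a mask $m\subseteq\{1,\dots,d\}$ (the parameters that survive pruning) and initial values $\theta^{0}\in\mathbb R^d$. Its sub-network has parameters $\theta\in\mathbb R^{m}$, and its loss is $\mathcal L$ with the pruned entries set to $0$. Phase 3 (training the winning ticket) is the following mechanism. Fix $1\le L\le N$, $I\ge 1$, a clipping factor $C>0$, learning rates $\eta_k\in\mathbb R$ and a noise level $\sigma$. Start from the restriction of $\theta^0$ to $m$. In each iteration $k=0,\dots,I-1$ draw a minibatch $B_k$ that contains each of the $N$ rows independently with probability $L/N$, put $g_k(x_i)=\nabla_{\theta_k}\mathcal L(\theta_k,x_i)$ for $i\in B_k$ (with value $0$ where the loss is not differentiable), and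 set $$\hat g_k=\frac1L\Big(\sum_{i\in B_k}\frac{g_k(x_i)}{\max(1,\|g_k(x_i)\|_2/C)}+\mathcal N(0,\sigma^2C^2\,\mathrm{Id})\Big),\qquad \theta_{k+1}=\theta_k-\eta_k\hat g_k ,$$ with fresh independent randomness in every iteration. The output is $\theta_I$, extended by $0$ on the pruned entries. Theorem. For every $K>0$ there is a constant $c=c(K)>0$, depending on nothing but $K$, such that the following holds for all $\mathcal X$, $d$, $N$, $L$, $I$, $C$, $(\eta_k)$, every loss $\mathcal L:\mathbb R^d\times\mathcal X\to\mathbb R$ and every ticket. Let $\epsilon_2>0$ and $0<\delta<1$ satisfy $$\epsilon_2\le K\,(L/N)^2\,I\qquad\text{and}\qquad \epsilon_2\le K\log(1/\delta).$$ If $$\sigma\ \ge\ c\,\frac{(L/N)\sqrt{I\log(1/\delta)}}{\epsilon_2},$$ then Phase 3 is $(\epsilon_2,\delta)$-differentially private. -/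

import Mathlib

open MeasureTheory ProbabilityTheory
open scoped ENNReal

noncomputable section

namespace DPLTM

/-- Two databases with `N` rows are neighbouring when they differ in exactly one row. -/
def Neighbouring {𝒳 : Type*} {N : ℕ} (x y : Fin N → 𝒳) : Prop :=
  ∃! i, x i ≠ y i

/-- `(ε, δ)`-differential privacy of a randomized mechanism, given by its output law on every
database. -/
def IsDP {𝒳 Ω : Type*} [MeasurableSpace Ω] {N : ℕ} (ε δ : ℝ)
    (M : (Fin N → 𝒳) → Measure Ω) : Prop :=
  ∀ x y : Fin N → 𝒳, Neighbouring x y → ∀ S : Set Ω, MeasurableSet S →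
    M x S ≤ ENNReal.ofReal (Real.exp ε) * M y S + ENNReal.ofReal δ

/-- A lottery ticket of a network with `d` parameters: the set of parameters that survive pruning
(the support of the 0/1 mask) and the initial values. -/
structure Ticket (d : ℕ) where
  mask : Finset (Fin d)
  init : EuclideanSpace ℝ (Fin d)

namespace Ticket

variable {d : ℕ} (T : Ticket d)

/-- The parameter space of the sub-network that the ticket describes. -/
abbrev Param : Type := EuclideanSpace ℝ T.mask

/-- Parameters of the sub-network as parameters of the full network, pruned entries being `0`. -/
def embed (w : T.Param) : EuclideanSpace ℝ (Fin d) :=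
  WithLp.toLp 2 fun i => if h : i ∈ T.mask then w ⟨i, h⟩ else 0

/-- The initial parameters of the sub-network. -/
def start : T.Param :=
  WithLp.toLp 2 fun i => T.init i

end Ticket

/-- Clipping in `ℓ²`-norm: `g / max (1, ‖g‖ / C)`. -/
def clip {E : Type*} [NormedAddCommGroup E] [NormedSpace ℝ E] (C : ℝ) (g : E) : E :=
  (max 1 (‖g‖ / C))⁻¹ • g

section Training

variable {𝒳 : Type*} {d N : ℕ} (loss : EuclideanSpace ℝ (Fin d) → 𝒳 → ℝ) (T : Ticket d)

/-- The gradient of the loss of the sub-network on the observation `x`. -/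
def perExampleGrad (w : T.Param) (x : 𝒳) : T.Param :=
  gradient (fun v => loss (T.embed v) x) w

/-- One update `w - η ĝ`, with
`ĝ = (1 / L) (∑_{i ∈ B} clip C (g (xᵢ)) + σ C z)`, for the minibatch `B` and the noise `z`. -/
def update (L : ℕ) (C σ η : ℝ) (X : Fin N → 𝒳) (B : Finset (Fin N)) (w z : T.Param) : T.Param :=
  w - η • ((L : ℝ)⁻¹ • (∑ i ∈ B, clip C (perExampleGrad loss T w (X i)) + (σ * C) • z))

/-- The probability of the minibatch `B` when every one of the `N` rows is taken independently
with probability `L / N`. -/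
def batchProb (N L : ℕ) (B : Finset (Fin N)) : ℝ :=
  ((L : ℝ) / N) ^ B.card * (1 - (L : ℝ) / N) ^ (N - B.card)

/-- The law of the parameters after one iteration from `w`: random minibatch, and an independent
standard Gaussian `z`, so that `(σ C) z` has law `𝒩(0, σ² C² Id)`. -/
def stepLaw (L : ℕ) (C σ η : ℝ) (X : Fin N → 𝒳) (w : T.Param) : Measure T.Param :=
  ∑ B : Finset (Fin N), ENNReal.ofReal (batchProb N L B) •
    (stdGaussian T.Param).map (update loss T L C σ η X B w)

/-- The law of the parameters of the sub-network after a given number of iterations, with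
learning rate `η k` in iteration `k` and fresh randomness in every iteration. -/
def paramLaw (L : ℕ) (C σ : ℝ) (η : ℕ → ℝ) (X : Fin N → 𝒳) : ℕ → Measure T.Param
  | 0 => Measure.dirac T.start
  | k + 1 => (paramLaw L C σ η X k).bind (stepLaw loss T L C σ (η k) X)

/-- Training the ticket for `I` iterations on the database `X`: the law of the parameters of
the trained (pruned) network. -/
def trainTicket (L : ℕ) (C σ : ℝ) (η : ℕ → ℝ) (I : ℕ) (X : Fin N → 𝒳) :
    Measure (EuclideanSpace ℝ (Fin d)) :=
  (paramLaw loss T L C σ η X I).map T.embed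

/-! The laws above are probability measures; in particular, all the maps along which measures
are pushed forward or bound are measurable. -/

lemma Ticket.measurable_embed : Measurable T.embed := by
  unfold Ticket.embed
  refine (WithLp.measurable_toLp 2 _).comp (measurable_pi_lambda _ fun i => ?_)
  by_cases h : i ∈ T.mask
  · simp only [h, dite_true]; fun_prop
  · simp only [h, dite_false]; fun_prop

lemma measurable_perExampleGrad (x : 𝒳) :
    Measurable fun w => perExampleGrad loss T w x := by
  unfold perExampleGrad gradient
  exact (LinearIsometryEquiv.continuous _).measurable.comp (measurable_fderiv ℝ _)

lemma measurable_update (L : ℕ) (C σ η : ℝ) (X : Fin N → 𝒳) (B : Finset (Fin N)) :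
    Measurable fun p : T.Param × T.Param => update loss T L C σ η X B p.1 p.2 := by
  have h : ∀ i, Measurable fun p : T.Param × T.Param =>
      perExampleGrad loss T p.1 (X i) :=
    fun i => (measurable_perExampleGrad loss T (X i)).comp measurable_fst
  unfold update clip
  fun_prop

lemma measurable_stepLaw (L : ℕ) (C σ η : ℝ) (X : Fin N → 𝒳) :
    Measurable (stepLaw loss T L C σ η X) := by
  refine Measure.measurable_of_measurable_coe _ fun S hS => ?_
  simp only [stepLaw, Measure.coe_finsetSum, Finset.sum_apply, Measure.smul_apply, smul_eq_mul]
  refine Finset.measurable_sum _ fun B _ => Measurable.const_mul ?_ _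
  have hu := measurable_update loss T L C σ η X B
  have : (fun w => (stdGaussian T.Param).map (update loss T L C σ η X B w) S) =
      fun w => stdGaussian T.Param (Prod.mk w ⁻¹'
        ((fun p : T.Param × T.Param => update loss T L C σ η X B p.1 p.2) ⁻¹' S)) := by
    funext w
    exact Measure.map_apply (hu.comp measurable_prodMk_left) hS
  rw [this]
  exact measurable_measure_prodMk_left (hu hS)

lemma sum_batchProb (N L : ℕ) : ∑ B : Finset (Fin N), batchProb N L B = 1 := by
  have h := Finset.sum_pow_mul_eq_add_pow ((L : ℝ) / N) (1 - (L : ℝ) / N)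
    (Finset.univ : Finset (Fin N))
  simpa [batchProb] using h

lemma isProbabilityMeasure_stepLaw {L : ℕ} (hL : L ≤ N) (C σ η : ℝ) (X : Fin N → 𝒳)
    (w : T.Param) : IsProbabilityMeasure (stepLaw loss T L C σ η X w) := by
  have hq : (L : ℝ) / N ≤ 1 := div_le_one_of_le₀ (by exact_mod_cast hL) (Nat.cast_nonneg N)
  have hq0 : (0 : ℝ) ≤ (L : ℝ) / N := by positivity
  have hB : ∀ B : Finset (Fin N), 0 ≤ batchProb N L B := fun B =>
    mul_nonneg (pow_nonneg hq0 _) (pow_nonneg (by linarith) _)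
  have hm : ∀ B, (stdGaussian T.Param).map (update loss T L C σ η X B w) Set.univ = 1 := by
    intro B
    have := Measure.isProbabilityMeasure_map (μ := stdGaussian T.Param)
      ((measurable_update loss T L C σ η X B).comp (measurable_prodMk_left (x := w))).aemeasurable
    exact this.measure_univ
  constructor
  simp only [stepLaw, Measure.coe_finsetSum, Finset.sum_apply, Measure.smul_apply, smul_eq_mul]
  rw [Finset.sum_congr rfl fun B _ => by rw [hm B, mul_one],
    ← ENNReal.ofReal_sum_of_nonneg fun B _ => hB B, sum_batchProb, ENNReal.ofReal_one]

lemma isProbabilityMeasure_trainTicket {L : ℕ} (hL : L ≤ N) (C σ : ℝ) (η : ℕ → ℝ) (I : ℕ)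
    (X : Fin N → 𝒳) : IsProbabilityMeasure (trainTicket loss T L C σ η I X) := by
  have h : ∀ k, IsProbabilityMeasure (paramLaw loss T L C σ η X k) := by
    intro k
    induction k with
    | zero => unfold paramLaw; infer_instance
    | succ k ih =>
      unfold paramLaw
      constructor
      rw [Measure.bind_apply MeasurableSet.univ (measurable_stepLaw loss T L C σ (η k) X).aemeasurable]
      have := fun w => (isProbabilityMeasure_stepLaw loss T hL C σ (η k) X w).measure_univ
      simp [this]
  have := h I
  exact Measure.isProbabilityMeasure_map T.measurable_embed.aemeasurable

end Training

end DPLTM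

end

namespace DPLTM

/-! This is a moments-accountant (Rényi) argument, with the Rényi bounds kept in dual form.
`HolderDominated p A μ ν` bounds the norm of dμ/dν in the exponent conjugate to p without mentioning
a density. It passes through images and mixtures, and under adaptive composition the constants
multiply (`HolderDominated.bind`), so I iterations cost I times the exponent of one.

For one iteration, condition on the part of the minibatch that avoids the differing row. What
remains is a fixed image of a standard Gaussian shifted with probability q = L/N by a vector v, and
clipping gives ‖v‖² ≤ 1/σ². Replacing the row changes v to another such v', so both mixtures are
compared with the unshifted Gaussian, one in each direction.

The density of a mixture is r = 1 - q + q exp(`logDensity v`). Its positive and negative n-th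
moments are exp(O(q²‖v‖²n²)) as long as n‖v‖² is small (`lintegral_pow_le`,
`lintegral_inv_mixDensity_pow_le`). The factor q² is the gain from subsampling. It appears because
by Cameron–Martin one factor exp(`logDensity v`) amounts to a translation by v, and this changes r
only by a further term of size q.

Young's inequality turns the resulting bound into (ε, δ)-privacy, and an order n of size log(1/δ)/ε
balances the two error terms. -/

lemma ofReal_exp_rpow (a b : ℝ) :
    ENNReal.ofReal (Real.exp a) ^ b = ENNReal.ofReal (Real.exp (a * b)) := by
  rw [ENNReal.ofReal_rpow_of_pos (Real.exp_pos a), Real.exp_mul]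

/-- The `L¹(μ)`-norm is at most `A` times the `Lᵖ(ν)`-norm. By duality this bounds the `p'`-norm of
the density of `μ` with respect to `ν`, hence a Rényi divergence. -/
def HolderDominated {Ω : Type*} [MeasurableSpace Ω] (p : ℝ) (A : ℝ≥0∞) (μ ν : Measure Ω) : Prop :=
  ∀ f : Ω → ℝ≥0∞, Measurable f → ∫⁻ x, f x ∂μ ≤ A * (∫⁻ x, f x ^ p ∂ν) ^ (1 / p)

/-! ### Calculus of Hölder domination -/

namespace HolderDominated

variable {Ω Ω' : Type*} [MeasurableSpace Ω] [MeasurableSpace Ω'] {p p' : ℝ} {A A' : ℝ≥0∞}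
  {μ ν ρ : Measure Ω}

lemma mono (h : HolderDominated p A μ ν) (hA : A ≤ A') : HolderDominated p A' μ ν :=
  fun f hf => (h f hf).trans (by gcongr)

/-- A weak triangle inequality: the price of an intermediate measure is that the exponents multiply.
-/
lemma trans (hp : 0 < p) (h : HolderDominated p A μ ν) (h' : HolderDominated p' A' ν ρ) :
    HolderDominated (p * p') (A * A' ^ (1 / p)) μ ρ := by
  intro f hf
  calc ∫⁻ x, f x ∂μ ≤ A * (∫⁻ x, f x ^ p ∂ν) ^ (1 / p) := h f hf
    _ ≤ A * (A' * (∫⁻ x, (f x ^ p) ^ p' ∂ρ) ^ (1 / p')) ^ (1 / p) := by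
        gcongr
        exact h' _ (hf.pow_const p)
    _ = A * A' ^ (1 / p) * (∫⁻ x, f x ^ (p * p') ∂ρ) ^ (1 / (p * p')) := by
        rw [ENNReal.mul_rpow_of_nonneg _ _ (by positivity), ← ENNReal.rpow_mul, mul_assoc]
        simp_rw [← ENNReal.rpow_mul]
        rw [show 1 / p' * (1 / p) = 1 / (p * p') by rw [one_div_mul_one_div, mul_comm p']]

lemma map (h : HolderDominated p A μ ν) {g : Ω → Ω'} (hg : Measurable g) :
    HolderDominated p A (μ.map g) (ν.map g) := by
  intro f hf
  rw [lintegral_map hf hg, lintegral_map (hf.pow_const p) hg]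
  exact h _ (hf.comp hg)

/-- Adaptive composition: the inner bound leaves the 1/p-th power of a function of x, and the outer
bound at the same p cancels that power. -/
lemma bind (hp : 0 < p) (h : HolderDominated p A μ ν) {κ κ' : Ω → Measure Ω'}
    (hκ : Measurable κ) (hκ' : Measurable κ') (hs : ∀ x, HolderDominated p A' (κ x) (κ' x)) :
    HolderDominated p (A * A') (μ.bind κ) (ν.bind κ') := by
  intro f hf
  have hm : Measurable fun x => ∫⁻ y, f y ^ p ∂κ' x :=
    (Measure.measurable_lintegral (hf.pow_const p)).comp hκ'
  rw [Measure.lintegral_bind hκ.aemeasurable hf.aemeasurable,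
    Measure.lintegral_bind hκ'.aemeasurable (hf.pow_const p).aemeasurable]
  calc ∫⁻ x, ∫⁻ y, f y ∂κ x ∂μ
      ≤ ∫⁻ x, A' * (∫⁻ y, f y ^ p ∂κ' x) ^ (1 / p) ∂μ := lintegral_mono fun x => hs x f hf
    _ = A' * ∫⁻ x, (∫⁻ y, f y ^ p ∂κ' x) ^ (1 / p) ∂μ := lintegral_const_mul _ (hm.pow_const _)
    _ ≤ A' * (A * (∫⁻ x, ((∫⁻ y, f y ^ p ∂κ' x) ^ (1 / p)) ^ p ∂ν) ^ (1 / p)) := by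
        gcongr
        exact h _ (hm.pow_const _)
    _ = A * A' * (∫⁻ x, ∫⁻ y, f y ^ p ∂κ' x ∂ν) ^ (1 / p) := by
        simp_rw [← ENNReal.rpow_mul, one_div_mul_cancel hp.ne', ENNReal.rpow_one]
        ring

/-- Concavity of the 1/p-th power. The weights must be the same on both sides. -/
lemma sum {ι : Type*} {s : Finset ι} {w : ι → ℝ≥0∞} (hw : ∑ i ∈ s, w i = 1) (hp : 1 ≤ p)
    {μ ν : ι → Measure Ω} (h : ∀ i ∈ s, HolderDominated p A (μ i) (ν i)) :
    HolderDominated p A (∑ i ∈ s, w i • μ i) (∑ i ∈ s, w i • ν i) := by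
  have hp0 : 0 < p := by linarith
  intro f hf
  simp only [lintegral_finsetSum_measure, lintegral_smul_measure, smul_eq_mul]
  calc ∑ i ∈ s, w i * ∫⁻ x, f x ∂μ i
      ≤ ∑ i ∈ s, A * (w i * (∫⁻ x, f x ^ p ∂ν i) ^ (1 / p)) := by
        refine Finset.sum_le_sum fun i hi => ?_
        calc w i * ∫⁻ x, f x ∂μ i ≤ w i * (A * (∫⁻ x, f x ^ p ∂ν i) ^ (1 / p)) := by
              gcongr
              exact h i hi f hf
          _ = _ := by ring
    _ = A * ∑ i ∈ s, w i * (∫⁻ x, f x ^ p ∂ν i) ^ (1 / p) := by rw [Finset.mul_sum]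
    _ ≤ A * (∑ i ∈ s, w i * ∫⁻ x, f x ^ p ∂ν i) ^ (1 / p) := by
        gcongr
        rw [one_div, ENNReal.le_rpow_inv_iff hp0]
        refine (ENNReal.rpow_arith_mean_le_arith_mean_rpow s w _ hw hp).trans_eq ?_
        simp_rw [← ENNReal.rpow_mul, inv_mul_cancel₀ hp0.ne', ENNReal.rpow_one]

/-- Conversion of a bound on a Rényi divergence into an `(ε, δ)`-bound. -/
lemma measure_le {R ε δ : ℝ} (hδ : 0 < δ) (hp : p.HolderConjugate p')
    (h : HolderDominated p (ENNReal.ofReal (Real.exp R)) μ ν)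
    (hR : (R - ε / p) * p' ≤ Real.log δ) {S : Set Ω} (hS : MeasurableSet S) :
    μ S ≤ ENNReal.ofReal (Real.exp ε) * ν S + ENNReal.ofReal δ := by
  have hp0 := hp.pos
  have key := h (S.indicator 1) (measurable_one.indicator hS)
  have hind : ∀ x, (S.indicator (1 : Ω → ℝ≥0∞) x) ^ p = S.indicator 1 x := by
    intro x
    by_cases hx : x ∈ S <;> simp [hx, hp0]
  simp only [hind, lintegral_indicator_one hS] at key
  have hdiv : ∀ (x : ℝ≥0∞) {r : ℝ}, 1 ≤ r → x / ENNReal.ofReal r ≤ x := fun x r hr =>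
    ENNReal.div_le_of_le_mul (le_mul_of_one_le_right' (by simpa using hr))
  refine key.trans ?_
  -- Splitting off exp(ε/p) makes Young's inequality return exactly exp(ε) ν(S) in its first term;
  -- the second is then at most δ by `hR`.
  have hab : ENNReal.ofReal (Real.exp R) * ν S ^ (1 / p) =
      (ENNReal.ofReal (Real.exp ε) * ν S) ^ (1 / p) *
        ENNReal.ofReal (Real.exp (R - ε / p)) := by
    rw [ENNReal.mul_rpow_of_nonneg _ _ (by positivity), ofReal_exp_rpow, mul_right_comm,
      ← ENNReal.ofReal_mul (Real.exp_nonneg _), ← Real.exp_add]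
    congr 4
    ring
  rw [hab]
  refine (ENNReal.young_inequality _ _ hp).trans ?_
  gcongr
  · refine (hdiv _ hp.lt.le).trans_eq ?_
    rw [← ENNReal.rpow_mul, one_div_mul_cancel hp0.ne', ENNReal.rpow_one]
  · refine (hdiv _ hp.symm.lt.le).trans ?_
    rw [ofReal_exp_rpow]
    apply ENNReal.ofReal_le_ofReal
    rw [← Real.exp_log hδ]
    simpa using hR

end HolderDominated

/-! ### Translations of Gaussian measures -/

section CameronMartin

/-- Mean shift of a real standard Gaussian as a change of density. -/
lemma gaussianReal_eq_withDensity (a : ℝ) :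
    gaussianReal a 1 = (gaussianReal 0 1).withDensity
      fun x => ENNReal.ofReal (Real.exp (a * x - a ^ 2 / 2)) := by
  rw [gaussianReal_of_var_ne_zero a one_ne_zero, gaussianReal_of_var_ne_zero 0 one_ne_zero,
    ← withDensity_mul _ (measurable_gaussianPDF 0 1) (by fun_prop)]
  congr 1
  ext x
  simp only [Pi.mul_apply, gaussianPDF, gaussianPDFReal]
  rw [← ENNReal.ofReal_mul (by positivity), mul_assoc (√_)⁻¹, ← Real.exp_add]
  congr 3
  simp
  ring

lemma pi_withDensity_prod {ι : Type*} [Fintype ι] (μ : ι → Measure ℝ)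
    [∀ i, IsProbabilityMeasure (μ i)] (ρ : ι → ℝ → ℝ≥0∞) (hρ : ∀ i, Measurable (ρ i))
    [∀ i, SigmaFinite ((μ i).withDensity (ρ i))] :
    Measure.pi (fun i => (μ i).withDensity (ρ i)) =
      (Measure.pi μ).withDensity fun x => ∏ i, ρ i (x i) := by
  classical
  refine Measure.pi_eq fun s hs => ?_
  rw [withDensity_apply _ (MeasurableSet.univ_pi hs),
    ← lintegral_indicator (MeasurableSet.univ_pi hs)]
  have hf : ∀ i, Measurable ((s i).indicator (ρ i)) := fun i => (hρ i).indicator (hs i)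
  have hind : ∀ x : ι → ℝ, (Set.univ.pi s).indicator (fun x => ∏ i, ρ i (x i)) x =
      ∏ i, (s i).indicator (ρ i) (x i) := by
    intro x
    by_cases hx : x ∈ Set.univ.pi s
    · rw [Set.indicator_of_mem hx]
      exact Finset.prod_congr rfl fun i _ => (Set.indicator_of_mem (hx i trivial) _).symm
    · rw [Set.indicator_of_notMem hx]
      obtain ⟨i, hi⟩ : ∃ i, x i ∉ s i := by simpa [Set.mem_pi] using hx
      exact (Finset.prod_eq_zero (Finset.mem_univ i) (Set.indicator_of_notMem hi _)).symm
  simp_rw [hind]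
  have := lintegral_prod_eq_prod_lintegral_of_indepFun (μ := Measure.pi μ) Finset.univ
    (fun i (x : ι → ℝ) => (s i).indicator (ρ i) (x i))
    (iIndepFun_pi (fun i => (hf i).aemeasurable)) fun i => (hf i).comp (measurable_pi_apply i)
  rw [this]
  refine Finset.prod_congr rfl fun i _ => ?_
  rw [withDensity_apply _ (hs i), ← lintegral_indicator (hs i),
    ← (measurePreserving_eval μ i).lintegral_comp (hf i)]

variable {ι : Type*} [Fintype ι]

/-- The logarithm of the density of a standard Gaussian shifted by `v`. -/
noncomputable def logDensity (v x : EuclideanSpace ℝ ι) : ℝ := inner ℝ v x - ‖v‖ ^ 2 / 2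

@[fun_prop]
lemma measurable_logDensity (v : EuclideanSpace ℝ ι) : Measurable (logDensity v) := by
  unfold logDensity
  fun_prop

lemma logDensity_add_self (v x : EuclideanSpace ℝ ι) :
    logDensity v (x + v) = logDensity v x + ‖v‖ ^ 2 := by
  simp only [logDensity, inner_add_right, real_inner_self_eq_norm_sq]
  ring

lemma logDensity_eq_sum (v x : EuclideanSpace ℝ ι) :
    logDensity v x = ∑ i, (v i * x i - v i ^ 2 / 2) := by
  rw [logDensity, EuclideanSpace.real_norm_sq_eq, Finset.sum_sub_distrib, Finset.sum_div,
    PiLp.inner_apply]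
  simp [mul_comm]

/-- The Cameron–Martin formula in finite dimension. -/
lemma lintegral_stdGaussian_add (v : EuclideanSpace ℝ ι) {F : EuclideanSpace ℝ ι → ℝ≥0∞}
    (hF : Measurable F) :
    ∫⁻ x, F (x + v) ∂stdGaussian (EuclideanSpace ℝ ι) =
      ∫⁻ x, ENNReal.ofReal (Real.exp (logDensity v x)) * F x
        ∂stdGaussian (EuclideanSpace ℝ ι) := by
  have hto : Measurable (WithLp.toLp 2 : (ι → ℝ) → EuclideanSpace ℝ ι) :=
    WithLp.measurable_toLp 2 _
  have hG : Measurable fun x : ι → ℝ => F (WithLp.toLp 2 x) := hF.comp hto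
  have hshift : (Measure.pi fun _ : ι => gaussianReal 0 1).map (fun x i => x i + v i) =
      (Measure.pi fun _ : ι => gaussianReal 0 1).withDensity
        fun x => ∏ i, ENNReal.ofReal (Real.exp (v i * x i - v i ^ 2 / 2)) := by
    have h1 : ∀ i, (gaussianReal 0 1).map (fun x => x + v i) = gaussianReal (v i) 1 := by
      intro i
      simp [gaussianReal_map_add_const]
    have : ∀ i, SigmaFinite ((gaussianReal 0 1).map fun x => x + v i) := fun i => by
      rw [h1]; infer_instance
    have : ∀ i, SigmaFinite ((gaussianReal 0 1).withDensity
        fun x => ENNReal.ofReal (Real.exp (v i * x - v i ^ 2 / 2))) := fun i => by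
      rw [← gaussianReal_eq_withDensity]; infer_instance
    rw [Measure.pi_map_pi (f := fun i x => x + v i) (fun i => by fun_prop)]
    simp_rw [h1, gaussianReal_eq_withDensity (v _)]
    exact pi_withDensity_prod _ _ fun i => by fun_prop
  rw [← map_pi_eq_stdGaussian, lintegral_map (by fun_prop) hto, lintegral_map (by fun_prop) hto]
  calc ∫⁻ x, F (WithLp.toLp 2 x + v) ∂(Measure.pi fun _ : ι => gaussianReal 0 1)
      = ∫⁻ x, F (WithLp.toLp 2 x)
          ∂(Measure.pi fun _ : ι => gaussianReal 0 1).map (fun x i => x i + v i) := by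
        rw [lintegral_map hG (by fun_prop)]
        rfl
    _ = _ := by
        rw [hshift, lintegral_withDensity_eq_lintegral_mul _ (by fun_prop) hG]
        refine lintegral_congr fun x => ?_
        simp only [Pi.mul_apply]
        rw [← ENNReal.ofReal_prod_of_nonneg fun i _ => (Real.exp_nonneg _), ← Real.exp_sum,
          logDensity_eq_sum]

lemma lintegral_exp_logDensity (v : EuclideanSpace ℝ ι) :
    ∫⁻ x, ENNReal.ofReal (Real.exp (logDensity v x)) ∂stdGaussian (EuclideanSpace ℝ ι) = 1 := by
  have := lintegral_stdGaussian_add v (F := fun _ => 1) measurable_const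
  simpa using this.symm

end CameronMartin

/-! ### Positive and negative moments of the mixture density -/

section Moments

variable {ι : Type*} [Fintype ι] {q : ℝ}

lemma one_sub_add_mul_exp_pos (hq0 : 0 ≤ q) (hq1 : q ≤ 1) (y : ℝ) :
    0 < 1 - q + q * Real.exp y := by
  have h := Real.exp_pos y
  rcases hq0.eq_or_lt with rfl | hq
  · norm_num
  · have := mul_pos hq h
    linarith

lemma exp_mul_le_one_sub_add_mul_exp (hq0 : 0 ≤ q) (hq1 : q ≤ 1) (y : ℝ) :
    Real.exp (q * y) ≤ 1 - q + q * Real.exp y := by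
  have := convexOn_exp.2 (Set.mem_univ 0) (Set.mem_univ y) (by linarith : 0 ≤ 1 - q) hq0
    (by ring)
  simpa using this

lemma one_add_mul_exp_sub_one_le {y : ℝ} (hq0 : 0 ≤ q) (hy0 : 0 ≤ y) (hy1 : y ≤ 1) :
    1 - q + q * Real.exp y ≤ Real.exp (2 * q * y) := by
  have h := Real.abs_exp_sub_one_le (x := y) (by rwa [abs_of_nonneg hy0])
  rw [abs_of_nonneg hy0] at h
  have h2 := (abs_le.1 h).2
  have h3 := Real.add_one_le_exp (2 * q * y)
  nlinarith

/-- The `m`-th moment of the density of a subsampled Gaussian, with an extra weight `exp l` on the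
shifted part. -/
lemma lintegral_pow_le (hq0 : 0 ≤ q) (hq1 : q ≤ 1) (v : EuclideanSpace ℝ ι) (m : ℕ) {l : ℝ}
    (hl : 0 ≤ l) (hml : l + 3 * m * ‖v‖ ^ 2 ≤ 1) :
    ∫⁻ x, ENNReal.ofReal ((1 - q + q * Real.exp (l + logDensity v x)) ^ m)
        ∂stdGaussian (EuclideanSpace ℝ ι) ≤
      ENNReal.ofReal (Real.exp (2 * q * m * l + 2 * q ^ 2 * ‖v‖ ^ 2 * m ^ 2)) := by
  induction m generalizing l with
  | zero => simp
  | succ m ih =>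
    set t := ‖v‖ ^ 2 with ht
    have ht0 : 0 ≤ t := by positivity
    have hm0 : (0 : ℝ) ≤ m := m.cast_nonneg
    push_cast at hml
    have hmt : 0 ≤ m * t := by positivity
    have hpos : ∀ y, 0 ≤ 1 - q + q * Real.exp y := fun y =>
      (one_sub_add_mul_exp_pos hq0 hq1 y).le
    set G : ℝ → EuclideanSpace ℝ ι → ℝ≥0∞ := fun l x =>
      ENNReal.ofReal ((1 - q + q * Real.exp (l + logDensity v x)) ^ m) with hG
    have hGm : ∀ l, Measurable (G l) := fun l => by fun_prop
    have hsplit : ∀ x, ENNReal.ofReal ((1 - q + q * Real.exp (l + logDensity v x)) ^ (m + 1)) =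
        ENNReal.ofReal (1 - q) * G l x + ENNReal.ofReal (q * Real.exp l) *
          (ENNReal.ofReal (Real.exp (logDensity v x)) * G l x) := by
      intro x
      have hpm : 0 ≤ (1 - q + q * Real.exp (l + logDensity v x)) ^ m := pow_nonneg (hpos _) m
      simp only [hG]
      rw [← ENNReal.ofReal_mul (Real.exp_nonneg _),
        ← ENNReal.ofReal_mul (p := q * Real.exp l) (by positivity),
        ← ENNReal.ofReal_mul (p := 1 - q) (by linarith), ← ENNReal.ofReal_add
          (mul_nonneg (by linarith) hpm) (by positivity), pow_succ]
      congr 1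
      rw [Real.exp_add]
      ring
    -- The translation by v raises `logDensity v` by t, so the integral keeps its form with l + t in
    -- place of l. This is why the induction carries the weight l.
    have hshift : ∫⁻ x, ENNReal.ofReal (Real.exp (logDensity v x)) * G l x
          ∂stdGaussian (EuclideanSpace ℝ ι) =
        ∫⁻ x, G (l + t) x ∂stdGaussian (EuclideanSpace ℝ ι) := by
      rw [← lintegral_stdGaussian_add v (hGm l)]
      refine lintegral_congr fun x => ?_
      simp only [hG, logDensity_add_self]
      rw [← ht, show l + (logDensity v x + t) = l + t + logDensity v x by ring]
    simp_rw [hsplit]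
    rw [lintegral_add_left (by fun_prop), lintegral_const_mul _ (hGm l),
      lintegral_const_mul _ (by fun_prop), hshift]
    have h1 := ih hl (by linarith)
    have h2 := ih (l := l + t) (by linarith) (by linarith)
    refine (add_le_add (mul_le_mul_right h1 _) (mul_le_mul_right h2 _)).trans ?_
    rw [← ENNReal.ofReal_mul (by linarith), ← ENNReal.ofReal_mul (by positivity),
      ← ENNReal.ofReal_add (mul_nonneg (by linarith) (Real.exp_nonneg _)) (by positivity)]
    apply ENNReal.ofReal_le_ofReal
    have hqm : q * (m * t) ≤ m * t := mul_le_of_le_one_left hmt hq1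
    have h3 := one_add_mul_exp_sub_one_le (y := l + 2 * q * m * t) hq0 (by positivity)
      (by nlinarith)
    calc (1 - q) * Real.exp (2 * q * m * l + 2 * q ^ 2 * t * m ^ 2) +
          q * Real.exp l * Real.exp (2 * q * m * (l + t) + 2 * q ^ 2 * t * m ^ 2)
        = Real.exp (2 * q * m * l + 2 * q ^ 2 * t * m ^ 2) *
            (1 - q + q * Real.exp (l + 2 * q * m * t)) := by
          rw [show 2 * q * m * (l + t) + 2 * q ^ 2 * t * m ^ 2 =
            (2 * q * m * l + 2 * q ^ 2 * t * m ^ 2) + 2 * q * m * t by ring,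
            Real.exp_add _ (2 * q * m * t), Real.exp_add l]
          ring
      _ ≤ Real.exp (2 * q * m * l + 2 * q ^ 2 * t * m ^ 2) *
            Real.exp (2 * q * (l + 2 * q * m * t)) := by gcongr
      _ ≤ _ := by
          rw [← Real.exp_add]
          apply Real.exp_le_exp.2
          push_cast
          have : 0 ≤ q ^ 2 * t := by positivity
          nlinarith

/-- The density of a standard Gaussian that is shifted by `v` with probability `q`. -/
noncomputable def mixDensity (q : ℝ) (v x : EuclideanSpace ℝ ι) : ℝ :=
  1 - q + q * Real.exp (logDensity v x)

@[fun_prop]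
lemma measurable_mixDensity (q : ℝ) (v : EuclideanSpace ℝ ι) : Measurable (mixDensity q v) := by
  unfold mixDensity
  fun_prop

lemma mixDensity_pos (hq0 : 0 ≤ q) (hq1 : q ≤ 1) (v x : EuclideanSpace ℝ ι) :
    0 < mixDensity q v x :=
  one_sub_add_mul_exp_pos hq0 hq1 _

lemma mixDensity_add_self (v x : EuclideanSpace ℝ ι) :
    mixDensity q v (x + v) =
      mixDensity q v x + q * Real.exp (logDensity v x) * (Real.exp (‖v‖ ^ 2) - 1) := by
  simp only [mixDensity, logDensity_add_self, Real.exp_add]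
  ring

/-- The tangent line of the convex function s ↦ s⁻ᵐ at r, obtained from Bernoulli's inequality. -/
lemma inv_pow_le_inv_pow_add {r d : ℝ} (hr : 0 < r) (hd : 0 ≤ d) (m : ℕ) :
    (r ^ m)⁻¹ ≤ ((r + d) ^ m)⁻¹ + m * (d * (r ^ (m + 1))⁻¹) := by
  have hrd : 0 < r + d := by linarith
  have hb := one_add_mul_le_pow (a := r / (r + d) - 1) (by
    have : 0 ≤ r / (r + d) := by positivity
    linarith) m
  rw [show 1 + (r / (r + d) - 1) = r / (r + d) by ring, div_pow] at hb
  have h2 : -(d / r) ≤ r / (r + d) - 1 := by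
    rw [show r / (r + d) - 1 = -(d / (r + d)) by field_simp; ring]
    gcongr
    linarith
  have h3 : 1 - m * (d / r) ≤ r ^ m / (r + d) ^ m := by
    have := mul_le_mul_of_nonneg_left h2 m.cast_nonneg (α := ℝ)
    linarith
  have h4 := mul_le_mul_of_nonneg_left h3 (inv_nonneg.2 (pow_pos hr m).le)
  have h5 : (r ^ m)⁻¹ * (r ^ m / (r + d) ^ m) = ((r + d) ^ m)⁻¹ := by field_simp
  have h6 : (r ^ m)⁻¹ * (1 - m * (d / r)) = (r ^ m)⁻¹ - m * (d * (r ^ (m + 1))⁻¹) := by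
    field_simp
    ring
  rw [h5, h6] at h4
  linarith

/-- By convexity r ≥ exp(q `logDensity v`), so r⁻ᵐ is at most a constant times the density of a
Gaussian shifted by -qm v. Finiteness is needed to absorb a term in
`lintegral_inv_mixDensity_pow_le`. -/
lemma lintegral_inv_mixDensity_pow_lt_top (hq0 : 0 ≤ q) (hq1 : q ≤ 1) (v : EuclideanSpace ℝ ι)
    (m : ℕ) :
    ∫⁻ x, ENNReal.ofReal ((mixDensity q v x ^ m)⁻¹) ∂stdGaussian (EuclideanSpace ℝ ι) < ∞ := by
  set u : EuclideanSpace ℝ ι := (-(q * m)) • v with hu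
  set c : ℝ := Real.exp (q * m * ‖v‖ ^ 2 / 2 + ‖u‖ ^ 2 / 2)
  have hle : ∀ x, ENNReal.ofReal ((mixDensity q v x ^ m)⁻¹) ≤
      ENNReal.ofReal c * ENNReal.ofReal (Real.exp (logDensity u x)) := by
    intro x
    rw [← ENNReal.ofReal_mul (Real.exp_nonneg _)]
    apply ENNReal.ofReal_le_ofReal
    have h1 : Real.exp (q * logDensity v x) ^ m ≤ mixDensity q v x ^ m :=
      pow_le_pow_left₀ (Real.exp_nonneg _) (exp_mul_le_one_sub_add_mul_exp hq0 hq1 _) m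
    refine (inv_anti₀ (by positivity) h1).trans_eq ?_
    rw [← Real.exp_nat_mul, ← Real.exp_neg, ← Real.exp_add]
    congr 1
    simp only [logDensity, hu, inner_smul_left]
    simp
    ring
  refine (lintegral_mono hle).trans_lt ?_
  rw [lintegral_const_mul _ (by fun_prop), lintegral_exp_logDensity]
  simp

/-- Let a m and b m be the means of r⁻ᵐ at x and at x + v. Writing r⁻ᵐ = r · r⁻ᵐ⁻¹ gives a (m+1) - a
m = q (a (m+1) - b (m+1)) by Cameron–Martin. The difference on the right carries a second factor q,
since r(x + v) - r(x) does. -/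
lemma lintegral_inv_mixDensity_pow_succ_le (hq0 : 0 ≤ q) (hq1 : q ≤ 1) (v : EuclideanSpace ℝ ι)
    (m : ℕ) :
    ∫⁻ x, ENNReal.ofReal ((mixDensity q v x ^ (m + 1))⁻¹) ∂stdGaussian (EuclideanSpace ℝ ι) ≤
      ∫⁻ x, ENNReal.ofReal ((mixDensity q v x ^ m)⁻¹) ∂stdGaussian (EuclideanSpace ℝ ι) +
      ENNReal.ofReal ((m + 1) * (Real.exp (‖v‖ ^ 2) - 1) * q ^ 2) *
        ∫⁻ x, ENNReal.ofReal ((mixDensity q v x ^ (m + 1))⁻¹)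
          ∂stdGaussian (EuclideanSpace ℝ ι) := by
  set γ := stdGaussian (EuclideanSpace ℝ ι)
  set e : ℝ := Real.exp (‖v‖ ^ 2) - 1 with he
  have he0 : 0 ≤ e := by
    have := Real.add_one_le_exp (‖v‖ ^ 2)
    have : 0 ≤ ‖v‖ ^ 2 := by positivity
    linarith
  have hpos := mixDensity_pos hq0 hq1 v
  set a : ℕ → ℝ≥0∞ := fun m => ∫⁻ x, ENNReal.ofReal ((mixDensity q v x ^ m)⁻¹) ∂γ with ha
  set b : ℕ → ℝ≥0∞ := fun m => ∫⁻ x, ENNReal.ofReal ((mixDensity q v (x + v) ^ m)⁻¹) ∂γ with hb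
  have hbe : ∀ m, b m = ∫⁻ x, ENNReal.ofReal (Real.exp (logDensity v x)) *
      ENNReal.ofReal ((mixDensity q v x ^ m)⁻¹) ∂γ := fun m =>
    lintegral_stdGaussian_add v (F := fun x => ENNReal.ofReal ((mixDensity q v x ^ m)⁻¹))
      (by fun_prop)
  have hba : ∀ m, b m ≤ a m := by
    intro m
    refine lintegral_mono fun x => ENNReal.ofReal_le_ofReal ?_
    have : mixDensity q v x ≤ mixDensity q v (x + v) := by
      rw [mixDensity_add_self]
      have : 0 ≤ q * Real.exp (logDensity v x) * (Real.exp (‖v‖ ^ 2) - 1) := by positivity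
      linarith
    have h0 := hpos x
    gcongr
  have hrec : ∀ m, a m = ENNReal.ofReal (1 - q) * a (m + 1) + ENNReal.ofReal q * b (m + 1) := by
    intro m
    rw [hbe, ha]
    simp only
    rw [← lintegral_const_mul _ (by fun_prop), ← lintegral_const_mul _ (by fun_prop),
      ← lintegral_add_left (by fun_prop)]
    refine lintegral_congr fun x => ?_
    have h0 := hpos x
    rw [← ENNReal.ofReal_mul (Real.exp_nonneg _), ← ENNReal.ofReal_mul hq0,
      ← ENNReal.ofReal_mul (by linarith),
      ← ENNReal.ofReal_add (mul_nonneg (by linarith) (by positivity)) (by positivity),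
      ← mul_assoc, ← add_mul]
    congr 1
    change _ = mixDensity q v x * _
    field_simp
    ring
  have hone : ∀ y : ℝ≥0∞, ENNReal.ofReal (1 - q) * y + ENNReal.ofReal q * y = y := by
    intro y
    rw [← add_mul, ← ENNReal.ofReal_add (by linarith) hq0]
    simp
  have hdiff : ∀ m : ℕ, a m ≤ b m + ENNReal.ofReal (m * e * q) * b (m + 1) := by
    intro m
    rw [hbe (m + 1), ← lintegral_const_mul _ (by fun_prop), hb]
    simp only
    rw [← lintegral_add_left (by fun_prop)]
    refine lintegral_mono fun x => ?_
    have h0 := hpos x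
    have h1 := hpos (x + v)
    rw [← ENNReal.ofReal_mul (Real.exp_nonneg _), ← ENNReal.ofReal_mul (by positivity),
      ← ENNReal.ofReal_add (by positivity) (by positivity)]
    apply ENNReal.ofReal_le_ofReal
    rw [mixDensity_add_self]
    refine (inv_pow_le_inv_pow_add h0
      (d := q * Real.exp (logDensity v x) * e) (by positivity) m).trans_eq ?_
    ring
  -- By `hrec`, a m is a convex combination of a (m+1) and b (m+1), of which b (m+1) is the smaller.
  have hbs : ∀ m, b (m + 1) ≤ a m := by
    intro m
    calc b (m + 1) = ENNReal.ofReal (1 - q) * b (m + 1) + ENNReal.ofReal q * b (m + 1) :=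
          (hone _).symm
      _ ≤ ENNReal.ofReal (1 - q) * a (m + 1) + ENNReal.ofReal q * b (m + 1) := by
          gcongr
          exact hba _
      _ = a m := (hrec m).symm
  calc a (m + 1) = ENNReal.ofReal (1 - q) * a (m + 1) + ENNReal.ofReal q * a (m + 1) :=
        (hone _).symm
    _ ≤ ENNReal.ofReal (1 - q) * a (m + 1) + ENNReal.ofReal q * (b (m + 1) +
          ENNReal.ofReal ((m + 1 : ℕ) * e * q) * a (m + 1)) := by
        gcongr
        refine (hdiff (m + 1)).trans ?_
        gcongr
        exact hbs _
    _ = a m + ENNReal.ofReal ((m + 1) * e * q ^ 2) * a (m + 1) := by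
        rw [hrec m, mul_add, ← mul_assoc (ENNReal.ofReal q), ← ENNReal.ofReal_mul hq0, ← add_assoc]
        congr 3
        push_cast
        ring

/-- The recursion has the new moment on both sides with coefficient w ≤ 1/2 on the right. Absorbing
it costs a factor 1/(1 - w) ≤ 1 + 2w ≤ exp(2w) per step. -/
lemma lintegral_inv_mixDensity_pow_le (hq0 : 0 ≤ q) (hq1 : q ≤ 1) (v : EuclideanSpace ℝ ι)
    (m : ℕ) (hm : 4 * m * ‖v‖ ^ 2 ≤ 1) :
    ∫⁻ x, ENNReal.ofReal ((mixDensity q v x ^ m)⁻¹) ∂stdGaussian (EuclideanSpace ℝ ι) ≤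
      ENNReal.ofReal (Real.exp (4 * q ^ 2 * ‖v‖ ^ 2 * m ^ 2)) := by
  induction m with
  | zero => simp
  | succ m ih =>
    set t := ‖v‖ ^ 2 with ht
    have ht0 : 0 ≤ t := by positivity
    have hm0 : (0 : ℝ) ≤ m := m.cast_nonneg
    have hmt : 0 ≤ m * t := by positivity
    push_cast at hm
    have ih := ih (by linarith)
    have hrec := lintegral_inv_mixDensity_pow_succ_le hq0 hq1 v m
    have hfin := (lintegral_inv_mixDensity_pow_lt_top hq0 hq1 v (m + 1)).ne
    generalize ∫⁻ x, ENNReal.ofReal ((mixDensity q v x ^ (m + 1))⁻¹)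
      ∂stdGaussian (EuclideanSpace ℝ ι) = y at hrec hfin ⊢
    lift y to NNReal using hfin
    rw [← ENNReal.ofReal_coe_nnreal (p := y)] at hrec ⊢
    have he : Real.exp t - 1 ≤ 2 * t := by
      have := Real.abs_exp_sub_one_le (x := t) (by rw [abs_of_nonneg ht0]; linarith)
      rw [abs_of_nonneg ht0] at this
      exact (abs_le.1 this).2
    have he0 : 0 ≤ Real.exp t - 1 := by linarith [Real.add_one_le_exp t]
    set w := (m + 1) * (Real.exp t - 1) * q ^ 2 with hw
    have hw0 : 0 ≤ w := by positivity
    have hwle : w ≤ (m + 1) * (2 * t) * q ^ 2 := by rw [hw]; gcongr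
    have hq2 : q ^ 2 ≤ 1 := pow_le_one₀ hq0 hq1
    have hwhalf : (m + 1) * (2 * t) * q ^ 2 ≤ 1 / 2 := by
      have : (m + 1) * (2 * t) * q ^ 2 ≤ (m + 1) * (2 * t) :=
        mul_le_of_le_one_right (by positivity) hq2
      linarith
    have hreal : (y : ℝ) ≤ Real.exp (4 * q ^ 2 * t * m ^ 2) + w * y := by
      have := hrec.trans (add_le_add_left ih _)
      rw [← ENNReal.ofReal_mul hw0, ← ENNReal.ofReal_add (Real.exp_nonneg _) (by positivity)] at this
      exact (ENNReal.ofReal_le_ofReal_iff (by positivity)).1 this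
    apply ENNReal.ofReal_le_ofReal
    have hy : (y : ℝ) ≤ Real.exp (4 * q ^ 2 * t * m ^ 2) * (1 + 2 * w) := by
      have hE := Real.exp_pos (4 * q ^ 2 * t * m ^ 2)
      have h1 : (y : ℝ) * (1 - w) ≤ Real.exp (4 * q ^ 2 * t * m ^ 2) := by linarith
      have h2 : 1 ≤ (1 - w) * (1 + 2 * w) := by nlinarith
      have hy0 : (0 : ℝ) ≤ y := y.2
      calc (y : ℝ) ≤ y * ((1 - w) * (1 + 2 * w)) := le_mul_of_one_le_right hy0 h2
        _ = (y * (1 - w)) * (1 + 2 * w) := by ring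
        _ ≤ _ := by gcongr
    calc (y : ℝ) ≤ Real.exp (4 * q ^ 2 * t * m ^ 2) * (1 + 2 * w) := hy
      _ ≤ Real.exp (4 * q ^ 2 * t * m ^ 2) * Real.exp (2 * w) := by
          gcongr
          linarith [Real.add_one_le_exp (2 * w)]
      _ ≤ _ := by
          rw [← Real.exp_add]
          apply Real.exp_le_exp.2
          push_cast
          have : 0 ≤ q ^ 2 * (m * t) := by positivity
          nlinarith

end Moments

/-! ### Hölder domination between subsampled Gaussians -/

section SubsampledGaussian

variable {ι : Type*} [Fintype ι] {q : ℝ}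

/-- The law of a standard Gaussian that is shifted by `v` with probability `q`. -/
noncomputable def gaussianMix (q : ℝ) (v : EuclideanSpace ℝ ι) : Measure (EuclideanSpace ℝ ι) :=
  ENNReal.ofReal (1 - q) • stdGaussian (EuclideanSpace ℝ ι) +
    ENNReal.ofReal q • (stdGaussian (EuclideanSpace ℝ ι)).map (· + v)

lemma lintegral_gaussianMix (hq0 : 0 ≤ q) (hq1 : q ≤ 1) (v : EuclideanSpace ℝ ι)
    {f : EuclideanSpace ℝ ι → ℝ≥0∞} (hf : Measurable f) :
    ∫⁻ x, f x ∂gaussianMix q v =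
      ∫⁻ x, ENNReal.ofReal (mixDensity q v x) * f x ∂stdGaussian (EuclideanSpace ℝ ι) := by
  rw [gaussianMix, lintegral_add_measure, lintegral_smul_measure, lintegral_smul_measure,
    lintegral_map hf (by fun_prop), lintegral_stdGaussian_add v hf, smul_eq_mul, smul_eq_mul,
    ← lintegral_const_mul _ hf, ← lintegral_const_mul _ (by fun_prop),
    ← lintegral_add_left (by fun_prop)]
  refine lintegral_congr fun x => ?_
  rw [← mul_assoc, ← add_mul, ← ENNReal.ofReal_mul hq0,
    ← ENNReal.ofReal_add (by linarith) (by positivity)]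
  rfl

lemma holderDominated_gaussianMix_stdGaussian (hq0 : 0 ≤ q) (hq1 : q ≤ 1)
    (v : EuclideanSpace ℝ ι) {n : ℕ} (hn : 2 ≤ n) (hv : 3 * n * ‖v‖ ^ 2 ≤ 1) :
    HolderDominated (n / (n - 1)) (ENNReal.ofReal (Real.exp (2 * q ^ 2 * ‖v‖ ^ 2 * n)))
      (gaussianMix q v) (stdGaussian (EuclideanSpace ℝ ι)) := by
  have hn2 : (2 : ℝ) ≤ n := by exact_mod_cast hn
  have hconj : (n : ℝ).HolderConjugate (n / (n - 1)) :=
    Real.HolderConjugate.conjExponent (by linarith)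
  intro f hf
  rw [lintegral_gaussianMix hq0 hq1 v hf]
  refine (ENNReal.lintegral_mul_le_Lp_mul_Lq _ hconj
    (f := fun x => ENNReal.ofReal (mixDensity q v x)) (by fun_prop) hf.aemeasurable).trans ?_
  gcongr
  have hpow : ∀ x, ENNReal.ofReal (mixDensity q v x) ^ (n : ℝ) =
      ENNReal.ofReal ((1 - q + q * Real.exp (0 + logDensity v x)) ^ n) := by
    intro x
    rw [ENNReal.rpow_natCast, ← ENNReal.ofReal_pow (mixDensity_pos hq0 hq1 v x).le, zero_add]
    rfl
  simp_rw [hpow]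
  calc _ ≤ ENNReal.ofReal (Real.exp (2 * q * n * 0 + 2 * q ^ 2 * ‖v‖ ^ 2 * n ^ 2)) ^
        (1 / (n : ℝ)) := by
        gcongr
        exact lintegral_pow_le hq0 hq1 v n le_rfl (by linarith)
    _ = _ := by
        rw [ofReal_exp_rpow]
        congr 2
        field_simp
        ring

/-- Insert 1 = r^(-1/p) r^(1/p) and apply Hölder with exponents n + 1 and p = (n + 1)/n: the first
factor becomes the moment of r⁻ⁿ, the second an integral against the mixture. -/
lemma holderDominated_stdGaussian_gaussianMix (hq0 : 0 ≤ q) (hq1 : q ≤ 1)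
    (v : EuclideanSpace ℝ ι) {n : ℕ} (hn : 1 ≤ n) (hv : 4 * n * ‖v‖ ^ 2 ≤ 1) :
    HolderDominated ((n + 1) / n) (ENNReal.ofReal (Real.exp (4 * q ^ 2 * ‖v‖ ^ 2 * n)))
      (stdGaussian (EuclideanSpace ℝ ι)) (gaussianMix q v) := by
  have hn1 : (1 : ℝ) ≤ n := by exact_mod_cast hn
  have hconj : ((n : ℝ) + 1).HolderConjugate ((n + 1) / n) := by
    have := Real.HolderConjugate.conjExponent (p := (n : ℝ) + 1) (by linarith)
    rwa [Real.conjExponent, add_sub_cancel_right] at this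
  set p : ℝ := (n + 1) / n with hp
  have hp0 : 0 < p := hconj.symm.pos
  set r : EuclideanSpace ℝ ι → ℝ≥0∞ := fun x => ENNReal.ofReal (mixDensity q v x) with hr
  have hrm : Measurable r := by fun_prop
  have hr0 : ∀ x, r x ≠ 0 := fun x => by
    simpa [hr] using mixDensity_pos hq0 hq1 v x
  have hrt : ∀ x, r x ≠ ∞ := fun x => ENNReal.ofReal_ne_top
  intro f hf
  rw [lintegral_gaussianMix hq0 hq1 v (hf.pow_const p)]
  have hsplit : ∀ x, f x = ((fun x => r x ^ (-(1 / p))) * fun x => r x ^ (1 / p) * f x) x := by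
    intro x
    simp only [Pi.mul_apply]
    rw [← mul_assoc, ← ENNReal.rpow_add _ _ (hr0 x) (hrt x)]
    simp
  calc ∫⁻ x, f x ∂stdGaussian (EuclideanSpace ℝ ι)
      = ∫⁻ x, ((fun x => r x ^ (-(1 / p))) * fun x => r x ^ (1 / p) * f x) x
          ∂stdGaussian (EuclideanSpace ℝ ι) := lintegral_congr hsplit
    _ ≤ (∫⁻ x, (r x ^ (-(1 / p))) ^ ((n : ℝ) + 1) ∂stdGaussian (EuclideanSpace ℝ ι)) ^
          (1 / ((n : ℝ) + 1)) *
        (∫⁻ x, (r x ^ (1 / p) * f x) ^ p ∂stdGaussian (EuclideanSpace ℝ ι)) ^ (1 / p) :=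
        ENNReal.lintegral_mul_le_Lp_mul_Lq _ hconj (by fun_prop) (by fun_prop)
    _ = (∫⁻ x, ENNReal.ofReal ((mixDensity q v x ^ n)⁻¹) ∂stdGaussian (EuclideanSpace ℝ ι)) ^
          (1 / ((n : ℝ) + 1)) *
        (∫⁻ x, r x * f x ^ p ∂stdGaussian (EuclideanSpace ℝ ι)) ^ (1 / p) := by
        congr 3
        · ext1 x
          have h0 := mixDensity_pos hq0 hq1 v x
          rw [← ENNReal.rpow_mul, show -(1 / p) * ((n : ℝ) + 1) = -(n : ℝ) by
            rw [hp]; field_simp, ENNReal.rpow_neg, ENNReal.rpow_natCast, hr,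
            ← ENNReal.ofReal_pow h0.le, ENNReal.ofReal_inv_of_pos (by positivity)]
        · ext1 x
          rw [ENNReal.mul_rpow_of_nonneg _ _ hp0.le, ← ENNReal.rpow_mul,
            one_div_mul_cancel hp0.ne', ENNReal.rpow_one]
    _ ≤ _ := by
        gcongr
        calc _ ≤ ENNReal.ofReal (Real.exp (4 * q ^ 2 * ‖v‖ ^ 2 * n ^ 2)) ^
              (1 / ((n : ℝ) + 1)) := by
              gcongr
              exact lintegral_inv_mixDensity_pow_le hq0 hq1 v n hv
          _ ≤ _ := by
              rw [ofReal_exp_rpow]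
              apply ENNReal.ofReal_le_ofReal
              apply Real.exp_le_exp.2
              rw [mul_one_div, div_le_iff₀ (by positivity)]
              have : 0 ≤ 4 * q ^ 2 * ‖v‖ ^ 2 * n := by positivity
              nlinarith

/-- Two subsampled Gaussians with shifts of norm at most `√t`. -/
lemma holderDominated_gaussianMix (hq0 : 0 ≤ q) (hq1 : q ≤ 1) {v v' : EuclideanSpace ℝ ι}
    {n : ℕ} (hn : 2 ≤ n) {t : ℝ} (ht : 4 * n * t ≤ 1) (hv : ‖v‖ ^ 2 ≤ t) (hv' : ‖v'‖ ^ 2 ≤ t) :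
    HolderDominated ((n + 1) / (n - 1)) (ENNReal.ofReal (Real.exp (6 * q ^ 2 * t * n)))
      (gaussianMix q v) (gaussianMix q v') := by
  have hn2 : (2 : ℝ) ≤ n := by exact_mod_cast hn
  have hn1 : (0 : ℝ) < n - 1 := by linarith
  have h4 : ∀ u : EuclideanSpace ℝ ι, ‖u‖ ^ 2 ≤ t → 4 * n * ‖u‖ ^ 2 ≤ 1 := fun u hu =>
    le_trans (by gcongr) ht
  have h3 : 3 * n * ‖v‖ ^ 2 ≤ 1 := le_trans (by gcongr; norm_num) (h4 v hv)
  have key := (holderDominated_gaussianMix_stdGaussian hq0 hq1 v hn h3).trans (by positivity)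
    (holderDominated_stdGaussian_gaussianMix hq0 hq1 v' (by omega) (h4 v' hv'))
  rw [show (n : ℝ) / (n - 1) * ((n + 1) / n) = (n + 1) / (n - 1) by field_simp,
    ofReal_exp_rpow, ← ENNReal.ofReal_mul (Real.exp_nonneg _), ← Real.exp_add] at key
  refine key.mono (ENNReal.ofReal_le_ofReal (Real.exp_le_exp.2 ?_))
  have h1 : 2 * q ^ 2 * ‖v‖ ^ 2 * n ≤ 2 * q ^ 2 * t * n := by gcongr
  have h2 : 4 * q ^ 2 * ‖v'‖ ^ 2 * n * (1 / (n / (n - 1))) ≤ 4 * q ^ 2 * t * n := by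
    have hle : 1 / ((n : ℝ) / (n - 1)) ≤ 1 := by
      rw [one_div_div, div_le_one (by positivity)]
      linarith
    calc _ ≤ 4 * q ^ 2 * ‖v'‖ ^ 2 * n * 1 := by gcongr
      _ ≤ _ := by rw [mul_one]; gcongr
  linarith

end SubsampledGaussian

/-! ### From one iteration to the whole training -/

section Training

variable {𝒳 : Type*} {d N : ℕ} (loss : EuclideanSpace ℝ (Fin d) → 𝒳 → ℝ) (T : Ticket d)

lemma norm_clip_le {E : Type*} [NormedAddCommGroup E] [NormedSpace ℝ E] {C : ℝ} (hC : 0 < C)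
    (g : E) : ‖clip C g‖ ≤ C := by
  have h1 : 0 < max 1 (‖g‖ / C) := lt_max_of_lt_left one_pos
  rw [clip, norm_smul, norm_inv, Real.norm_of_nonneg h1.le, inv_mul_le_iff₀ h1, ← div_le_iff₀ hC]
  exact le_max_right _ _

/-- The probability of drawing the minibatch `B` from all rows but one. -/
noncomputable def batchProbErase (N L : ℕ) (B : Finset (Fin N)) : ℝ :=
  ((L : ℝ) / N) ^ B.card * (1 - (L : ℝ) / N) ^ (N - 1 - B.card)

lemma sum_batchProbErase (N L : ℕ) (i : Fin N) :
    ∑ B ∈ (Finset.univ.erase i).powerset, batchProbErase N L B = 1 := by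
  have h := Finset.sum_pow_mul_eq_add_pow ((L : ℝ) / N) (1 - (L : ℝ) / N)
    (Finset.univ.erase i)
  rw [Finset.card_erase_of_mem (Finset.mem_univ i), Finset.card_univ, Fintype.card_fin] at h
  simpa [batchProbErase] using h

lemma batchProbErase_nonneg {N L : ℕ} (hL : L ≤ N) (B : Finset (Fin N)) :
    0 ≤ batchProbErase N L B := by
  have hq1 : (L : ℝ) / N ≤ 1 := div_le_one_of_le₀ (by exact_mod_cast hL) (Nat.cast_nonneg N)
  exact mul_nonneg (by positivity) (pow_nonneg (by linarith) _)

/-- The noise shift that has the same effect as adding row `x` to the minibatch. -/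
noncomputable def rowShift (C σ : ℝ) (w : T.Param) (x : 𝒳) : T.Param :=
  (σ * C)⁻¹ • clip C (perExampleGrad loss T w x)

lemma norm_rowShift_sq_le {C σ : ℝ} (hC : 0 < C) (hσ : 0 < σ) (w : T.Param) (x : 𝒳) :
    ‖rowShift loss T C σ w x‖ ^ 2 ≤ (σ ^ 2)⁻¹ := by
  have h : ‖rowShift loss T C σ w x‖ ≤ σ⁻¹ := by
    rw [rowShift, norm_smul, norm_inv, Real.norm_of_nonneg (by positivity), mul_inv, mul_assoc]
    refine mul_le_of_le_one_right (by positivity) ?_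
    rw [inv_mul_le_iff₀ hC, mul_one]
    exact norm_clip_le hC _
  calc _ ≤ σ⁻¹ ^ 2 := by gcongr
    _ = _ := inv_pow _ _

lemma update_insert {L : ℕ} {C σ : ℝ} (hC : 0 < C) (hσ : 0 < σ) (η : ℝ) (X : Fin N → 𝒳)
    {B : Finset (Fin N)} {i : Fin N} (hi : i ∉ B) (w z : T.Param) :
    update loss T L C σ η X (insert i B) w z =
      update loss T L C σ η X B w (z + rowShift loss T C σ w (X i)) := by
  have : (σ * C) • rowShift loss T C σ w (X i) = clip C (perExampleGrad loss T w (X i)) := by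
    rw [rowShift, smul_smul, mul_inv_cancel₀ (by positivity), one_smul]
  rw [update, update, Finset.sum_insert hi, smul_add (σ * C), this]
  congr 3
  abel

/-- One iteration as a mixture, over the minibatches from the other rows, of images of Gaussians
subsampled in row `i`. -/
lemma stepLaw_eq_sum_gaussianMix {L : ℕ} (hL : L ≤ N) {C σ : ℝ} (hC : 0 < C) (hσ : 0 < σ) (η : ℝ)
    (X : Fin N → 𝒳) (i : Fin N) (w : T.Param) :
    stepLaw loss T L C σ η X w = ∑ B ∈ (Finset.univ.erase i).powerset,
      ENNReal.ofReal (batchProbErase N L B) •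
        (gaussianMix ((L : ℝ) / N) (rowShift loss T C σ w (X i))).map
          (update loss T L C σ η X B w) := by
  have hq1 : (L : ℝ) / N ≤ 1 := div_le_one_of_le₀ (by exact_mod_cast hL) (Nat.cast_nonneg N)
  have hq0 : (0 : ℝ) ≤ (L : ℝ) / N := by positivity
  have hN : 0 < N := i.pos
  have hu : ∀ B, Measurable (update loss T L C σ η X B w) := fun B =>
    (measurable_update loss T L C σ η X B).comp measurable_prodMk_left
  rw [stepLaw, ← Finset.powerset_univ, ← Finset.insert_erase (Finset.mem_univ i),
    Finset.sum_powerset_insert (Finset.notMem_erase i _), ← Finset.sum_add_distrib,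
    Finset.insert_erase (Finset.mem_univ i)]
  refine Finset.sum_congr rfl fun B hB => ?_
  have hiB : i ∉ B := fun h => Finset.notMem_erase i _ (Finset.mem_powerset.1 hB h)
  have hcard : B.card ≤ N - 1 := by
    have := Finset.card_le_card (Finset.mem_powerset.1 hB)
    rwa [Finset.card_erase_of_mem (Finset.mem_univ i), Finset.card_univ, Fintype.card_fin] at this
  have h1 : batchProb N L B = batchProbErase N L B * (1 - (L : ℝ) / N) := by
    rw [batchProb, batchProbErase, mul_assoc, ← pow_succ,
      show N - 1 - B.card + 1 = N - B.card by omega]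
  have h2 : batchProb N L (insert i B) = batchProbErase N L B * ((L : ℝ) / N) := by
    rw [batchProb, batchProbErase, Finset.card_insert_of_notMem hiB,
      show N - (B.card + 1) = N - 1 - B.card by omega, pow_succ]
    ring
  have h3 : (stdGaussian T.Param).map (update loss T L C σ η X (insert i B) w) =
      ((stdGaussian T.Param).map (· + rowShift loss T C σ w (X i))).map
        (update loss T L C σ η X B w) := by
    rw [Measure.map_map (hu B) (by fun_prop)]
    congr 1
    ext1 z
    exact update_insert loss T hC hσ η X hiB w z
  have hB0 := batchProbErase_nonneg hL B
  rw [h1, h2, h3, ENNReal.ofReal_mul hB0, ENNReal.ofReal_mul hB0, gaussianMix,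
    Measure.map_add _ _ (hu B), Measure.map_smul, Measure.map_smul, smul_add, smul_smul, smul_smul]

lemma update_congr {L : ℕ} {C σ η : ℝ} {X Y : Fin N → 𝒳} {B : Finset (Fin N)}
    (h : ∀ j ∈ B, X j = Y j) (w : T.Param) :
    update loss T L C σ η X B w = update loss T L C σ η Y B w := by
  ext1 z
  rw [update, update, Finset.sum_congr rfl fun j hj => by rw [h j hj]]

/-- Once the differing row is split off, both laws have the same weights and the same update maps,
and only the shifts of the subsampled Gaussians differ. -/
lemma holderDominated_stepLaw {L : ℕ} (hL : L ≤ N) {C σ : ℝ} (hC : 0 < C) (hσ : 0 < σ) (η : ℝ)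
    {X Y : Fin N → 𝒳} (hXY : Neighbouring X Y) {n : ℕ} (hn : 2 ≤ n) (hnσ : 4 * n * (σ ^ 2)⁻¹ ≤ 1)
    (w : T.Param) :
    HolderDominated ((n + 1) / (n - 1))
      (ENNReal.ofReal (Real.exp (6 * ((L : ℝ) / N) ^ 2 * (σ ^ 2)⁻¹ * n)))
      (stepLaw loss T L C σ η X w) (stepLaw loss T L C σ η Y w) := by
  have hq1 : (L : ℝ) / N ≤ 1 := div_le_one_of_le₀ (by exact_mod_cast hL) (Nat.cast_nonneg N)
  have hq0 : (0 : ℝ) ≤ (L : ℝ) / N := by positivity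
  have hn2 : (2 : ℝ) ≤ n := by exact_mod_cast hn
  obtain ⟨i, -, hi⟩ := hXY
  rw [stepLaw_eq_sum_gaussianMix loss T hL hC hσ η X i w,
    stepLaw_eq_sum_gaussianMix loss T hL hC hσ η Y i w]
  refine HolderDominated.sum ?_ ?_ fun B hB => ?_
  · rw [← ENNReal.ofReal_sum_of_nonneg fun B _ => batchProbErase_nonneg hL B,
      sum_batchProbErase, ENNReal.ofReal_one]
  · rw [le_div_iff₀ (by linarith)]
    linarith
  · have hcongr : update loss T L C σ η X B w = update loss T L C σ η Y B w := by
      refine update_congr loss T (fun j hj => ?_) w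
      by_contra hne
      exact Finset.ne_of_mem_erase (Finset.mem_powerset.1 hB hj) (hi j hne)
    rw [hcongr]
    exact (holderDominated_gaussianMix hq0 hq1 hn hnσ (norm_rowShift_sq_le loss T hC hσ w _)
      (norm_rowShift_sq_le loss T hC hσ w _)).map
        ((measurable_update loss T L C σ η Y B).comp measurable_prodMk_left)

lemma holderDominated_paramLaw {L : ℕ} (hL : L ≤ N) {C σ : ℝ} (hC : 0 < C) (hσ : 0 < σ)
    (η : ℕ → ℝ) {X Y : Fin N → 𝒳} (hXY : Neighbouring X Y) {n : ℕ} (hn : 2 ≤ n)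
    (hnσ : 4 * n * (σ ^ 2)⁻¹ ≤ 1) (k : ℕ) :
    HolderDominated ((n + 1) / (n - 1))
      (ENNReal.ofReal (Real.exp (k * (6 * ((L : ℝ) / N) ^ 2 * (σ ^ 2)⁻¹ * n))))
      (paramLaw loss T L C σ η X k) (paramLaw loss T L C σ η Y k) := by
  have hn2 : (2 : ℝ) ≤ n := by exact_mod_cast hn
  have hp : (0 : ℝ) < (n + 1) / (n - 1) := div_pos (by linarith) (by linarith)
  induction k with
  | zero =>
    intro f hf
    rw [paramLaw, paramLaw, lintegral_dirac' _ hf, lintegral_dirac' _ (hf.pow_const _),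
      ← ENNReal.rpow_mul, mul_one_div_cancel hp.ne']
    simp
  | succ k ih =>
    rw [paramLaw, paramLaw]
    refine (ih.bind hp (measurable_stepLaw loss T L C σ (η k) X)
      (measurable_stepLaw loss T L C σ (η k) Y)
      (holderDominated_stepLaw loss T hL hC hσ (η k) hXY hn hnσ)).mono ?_
    rw [← ENNReal.ofReal_mul (Real.exp_nonneg _), ← Real.exp_add]
    apply le_of_eq
    congr 2
    push_cast
    ring

/-- Privacy of training in terms of a Rényi order `n`. -/
lemma isDP_trainTicket {L : ℕ} (hL : L ≤ N) {C σ : ℝ} (hC : 0 < C) (hσ : 0 < σ) (η : ℕ → ℝ)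
    {n : ℕ} (hn : 2 ≤ n) (hnσ : 4 * n * (σ ^ 2)⁻¹ ≤ 1) {I : ℕ} {ε δ : ℝ} (hδ : 0 < δ)
    (hε : I * (6 * ((L : ℝ) / N) ^ 2 * (σ ^ 2)⁻¹ * n) * (n + 1) + 2 * Real.log (1 / δ) ≤
      ε * (n - 1)) :
    IsDP ε δ (fun X : Fin N → 𝒳 => trainTicket loss T L C σ η I X) := by
  intro X Y hXY S hS
  have hn2 : (2 : ℝ) ≤ n := by exact_mod_cast hn
  have hn1 : (0 : ℝ) < n - 1 := by linarith
  have hconj : ((n + 1 : ℝ) / (n - 1)).HolderConjugate ((n + 1) / 2) := by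
    rw [Real.holderConjugate_iff]
    refine ⟨by rw [lt_div_iff₀ hn1]; linarith, ?_⟩
    field_simp
    ring
  refine ((holderDominated_paramLaw loss T hL hC hσ η hXY hn hnσ I).map
    T.measurable_embed).measure_le hδ hconj ?_ hS
  rw [one_div, Real.log_inv] at hε
  set R := I * (6 * ((L : ℝ) / N) ^ 2 * (σ ^ 2)⁻¹ * n)
  have : (R - ε / ((n + 1) / (n - 1))) * ((n + 1) / 2) = (R * (n + 1) - ε * (n - 1)) / 2 := by
    field_simp
  rw [this]
  linarith

end Training

end DPLTM

/-! ### Choice of the order and of the constant -/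

theorem mainTheorem3 (K : ℝ) (hK : 0 < K) :
    ∃ c : ℝ, 0 < c ∧
      ∀ (𝒳 : Type*) (d N L I : ℕ) (loss : EuclideanSpace ℝ (Fin d) → 𝒳 → ℝ)
        (T : DPLTM.Ticket d) (C σ ε₂ δ : ℝ) (η : ℕ → ℝ),
        1 ≤ L → L ≤ N → 1 ≤ I → 0 < C → 0 < ε₂ → 0 < δ → δ < 1 →
        ε₂ ≤ K * (((L : ℝ) / N) ^ 2 * I) →
        ε₂ ≤ K * Real.log (1 / δ) →
        c * ((L : ℝ) / N * √(I * Real.log (1 / δ)) / ε₂) ≤ σ →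
        DPLTM.IsDP ε₂ δ
          (fun X : Fin N → 𝒳 => DPLTM.trainTicket loss T L C σ η I X) := by
  -- With m = ⌈4l/ε⌉ and ε ≤ K l one gets ε(m + 2) ≤ 4l + 3ε ≤ A l.
  set A : ℝ := 4 + 3 * K with hA
  have hA0 : 0 < A := by positivity
  refine ⟨2 * A, by positivity, ?_⟩
  intro 𝒳 d N L I loss T C σ ε δ η hL1 hLN hI hC hε hδ hδ1 hεI hεδ hσ
  set l := Real.log (1 / δ) with hl
  have hl0 : 0 < l := Real.log_pos (by rw [lt_div_iff₀ hδ]; linarith)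
  set q : ℝ := (L : ℝ) / N with hq
  have hL0 : (0 : ℝ) < L := by exact_mod_cast hL1
  have hN0 : (0 : ℝ) < N := by exact_mod_cast hL1.trans hLN
  have hI0 : (0 : ℝ) < I := by exact_mod_cast hI
  have hq0 : 0 < q := by positivity
  have hσ0 : 0 < σ := lt_of_lt_of_le (by positivity) hσ
  have hσ2 : 4 * A ^ 2 * (q ^ 2 * I * l) ≤ ε ^ 2 * σ ^ 2 := by
    have h1 : 2 * A * (q * √(I * l)) ≤ ε * σ := by
      have := mul_le_mul_of_nonneg_left hσ hε.le
      calc _ = ε * (2 * A * (q * √(I * l) / ε)) := by field_simp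
        _ ≤ _ := this
    have h2 := pow_le_pow_left₀ (by positivity) h1 2
    have h3 : √(I * l) ^ 2 = I * l := Real.sq_sqrt (by positivity)
    calc _ = (2 * A * (q * √(I * l))) ^ 2 := by rw [mul_pow, mul_pow, mul_pow q, h3]; ring
      _ ≤ _ := h2
      _ = _ := by ring
  obtain ⟨m, hm1, hm2⟩ : ∃ m : ℕ, 4 * l ≤ ε * m ∧ ε * m ≤ 4 * l + ε := by
    refine ⟨⌈4 * l / ε⌉₊, ?_, ?_⟩
    · have := Nat.le_ceil (4 * l / ε)
      rwa [div_le_iff₀' hε] at this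
    · have := (Nat.ceil_lt_add_one (by positivity : 0 ≤ 4 * l / ε)).le
      calc _ ≤ ε * (4 * l / ε + 1) := by gcongr
        _ = _ := by field_simp
  have hm0 : 1 ≤ m := by
    rcases Nat.eq_zero_or_pos m with rfl | h
    · simp only [Nat.cast_zero, mul_zero] at hm1
      linarith
    · exact h
  have hnA : ε * ((m : ℝ) + 2) ≤ A * l := by
    rw [hA]
    linarith
  have hn0 : (0 : ℝ) ≤ m := m.cast_nonneg
  -- For n = m + 1 the budget ε(n - 1) = εm is at least 4l: half pays for the 2 log(1/δ), half for
  -- the accumulated Rényi term.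
  refine DPLTM.isDP_trainTicket loss T hLN hC hσ0 η (n := m + 1) (by omega) ?_ hδ ?_
  · rw [← div_eq_mul_inv, div_le_one (by positivity)]
    refine le_of_mul_le_mul_left ?_ (by positivity : 0 < ε ^ 2)
    refine le_trans ?_ hσ2
    push_cast
    calc ε ^ 2 * (4 * ((m : ℝ) + 1)) ≤ ε ^ 2 * (4 * ((m : ℝ) + 2)) := by gcongr; norm_num
      _ = 4 * ε * (ε * ((m : ℝ) + 2)) := by ring
      -- The bound ε ≤ K q² I serves only here: it keeps n within the range, 4n ≤ σ², of the moment
      -- bounds.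
      _ ≤ 4 * (A * (q ^ 2 * I)) * (A * l) := by
          gcongr
          refine hεI.trans ?_
          gcongr
          rw [hA]
          linarith
      _ = _ := by ring
  · rw [← hq, ← hl]
    push_cast
    have key : I * (6 * q ^ 2 * (σ ^ 2)⁻¹ * ((m : ℝ) + 1)) * ((m : ℝ) + 1 + 1) ≤ 2 * l := by
      rw [show I * (6 * q ^ 2 * (σ ^ 2)⁻¹ * ((m : ℝ) + 1)) * ((m : ℝ) + 1 + 1) =
        6 * (q ^ 2 * I) * (((m : ℝ) + 1) * ((m : ℝ) + 2)) / σ ^ 2 by rw [div_eq_mul_inv]; ring,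
        div_le_iff₀ (by positivity)]
      refine le_of_mul_le_mul_left ?_ (by positivity : 0 < ε ^ 2)
      calc ε ^ 2 * (6 * (q ^ 2 * I) * (((m : ℝ) + 1) * ((m : ℝ) + 2)))
          ≤ ε ^ 2 * (6 * (q ^ 2 * I) * (((m : ℝ) + 2) * ((m : ℝ) + 2))) := by
            gcongr
            norm_num
        _ = 6 * (q ^ 2 * I) * (ε * ((m : ℝ) + 2)) ^ 2 := by ring
        _ ≤ 6 * (q ^ 2 * I) * (A * l) ^ 2 := by gcongr
        _ ≤ 8 * (q ^ 2 * I) * (A * l) ^ 2 := by gcongr; norm_num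
        _ = 2 * l * (4 * A ^ 2 * (q ^ 2 * I * l)) := by ring
        _ ≤ 2 * l * (ε ^ 2 * σ ^ 2) := by gcongr
        _ = _ := by ring
    linarith
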